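/- Let $n\ge 2$, let $X\subset\mathbb R^n$ be a finite set and $w$ a positive real weight function on $X$. Suppose that $X$ is supported by $p$ concentric spheres, that is, $X=X_1\cup\dots\cup X_p$, where $r_1,\dots,r_p\ge 0$ are distinct and $X_\nu=X\cap S_\nu\neq\emptyset$, with $S_\nu$ the sphere of radius $r_\nu$ centred at the origin (radius $0$ is allowed). Let $t\ge 0$ be an integer and suppose that $(X,w)$ is a Euclidean $t$-design, that is, $$\sum_{\nu=1}^p \Big(\sum_{x\in X_\nu}w(x)\Big)\frac{1}{|S_\nu|}\int_{S_\nu} f\,d\sigma_\nu=\sum_{u\in X}w(u)f(u)$$ for every real polynomial $f$ in $n$ variables of degree at most $t$, where $\sigma_\nu$ is the surface measure on $S_\nu$ and the mean value over $S_\nu$ is read as $f(0)$ if $r_\nu=0$. Suppose that $w$ is constant on each $X_\nu$. Put $\varepsilon_S=1$ if $0\in X$ and $\varepsilon_S=0$ otherwise. For $\lambda,\mu$ with $r_\lambda,r_\mu\neq0$ let $$s_{\lambda,\mu}=\left|\left\{\frac{x\cdot y}{r_\lambda r_\mu} : x\in X_\lambda,\ y\in X_\mu,\ x\neq y\right\}\right|.$$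 Assume that one of the following two conditions holds: (1) $s_{\lambda,\nu}+s_{\nu,\mu}\le t-2(p-\varepsilon_S-2)$ for all $\lambda,\nu,\mu\in\{1,\dots,p\}$ with $r_\lambda,r_\nu,r_\mu\ne0$; (2) $X=-X$, and $s_{\lambda,\nu}+s_{\nu,\mu}-\delta_{\lambda,\nu}-\delta_{\nu,\mu}\le t-2(p-\varepsilon_S-2)$ for all $\lambda,\nu,\mu\in\{1,\dots,p\}$ with $r_\lambda,r_\nu,r_\mu\ne0$, where $\delta$ is the Kronecker delta. Then $X$ has the structure of a coherent configuration, whose relations are the nonempty sets among $$R_{\lambda,\mu,\alpha}=\left\{(x,y)\in X_\lambda\times X_\mu : \frac{x\cdot y}{r_\lambda r_\mu}=\alpha\right\}\quad(r_\lambda,r_\mu\neq0,\ \alpha\in\mathbb R),$$ together with the sets $X_\lambda\times X_\mu$ with $r_\lambda=0$ or $r_\mu=0$. That is, these relations partition $X\times X$; the diagonal $\{(x,x):x\in X\}$ is a union of some of them; the transpose of each of them is again one of them; and for any three of them, $R_1,R_2,R_3$, the number of $z\in X$ with $(x,z)\in R_1$ and $(z,y)\in R_2$ is the same for all $(x,y)\in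 R_3$. -/

import Mathlib

open MeasureTheory

noncomputable section

namespace EuclideanDesign

/-- The layer `X_i = X ∩ S^{n-1}(r_i)`. -/
def layer {n p : ℕ} (X : Finset (EuclideanSpace ℝ (Fin n))) (r : Fin p → ℝ) (i : Fin p) :
    Finset (EuclideanSpace ℝ (Fin n)) :=
  X.filter fun x => ‖x‖ = r i

/-- `X` is supported by the `p` concentric spheres of distinct radii `r_1, …, r_p` about the origin:
every point of `X` lies on one of them, and each of them meets `X`
(so all radii are nonnegative; the radius `0` is allowed). -/
structure IsSupportedBy {n p : ℕ} (X : Finset (EuclideanSpace ℝ (Fin n))) (r : Fin p → ℝ) :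
    Prop where
  radii_injective : Function.Injective r
  layer_nonempty : ∀ i, (layer X r i).Nonempty
  cover : ∀ x ∈ X, ∃ i, ‖x‖ = r i

/-- The mean value `|S|⁻¹ ∫_S f dσ` over the sphere `S = S^{n-1}(ρ)`, computed on the unit sphere
with its surface measure through the dilation `u ↦ ρ • u`. For `ρ = 0` (and `n ≥ 1`) it is `f 0`. -/
def sphereMean {n : ℕ} (ρ : ℝ) (f : EuclideanSpace ℝ (Fin n) → ℝ) : ℝ :=
  ⨍ u : Metric.sphere (0 : EuclideanSpace ℝ (Fin n)) 1,
    f (ρ • (u : EuclideanSpace ℝ (Fin n))) ∂(volume : Measure (EuclideanSpace ℝ (Fin n))).toSphere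

/-- The weighted set `(X, w)`, supported by the spheres of radii `r_1, …, r_p`, is a Euclidean
`t`-design: the weights are positive, and
`∑_i w(X_i) |S_i|⁻¹ ∫_{S_i} f dσ_i = ∑_{u ∈ X} w(u) f(u)`
for every real polynomial `f` of degree at most `t`. -/
structure IsDesign {n p : ℕ} (t : ℕ) (X : Finset (EuclideanSpace ℝ (Fin n)))
    (w : EuclideanSpace ℝ (Fin n) → ℝ) (r : Fin p → ℝ) : Prop where
  supported : IsSupportedBy X r
  weight_pos : ∀ x ∈ X, 0 < w x
  cubature : ∀ f : MvPolynomial (Fin n) ℝ, f.totalDegree ≤ t →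
    ∑ i, (∑ x ∈ layer X r i, w x) * sphereMean (r i) (fun x => MvPolynomial.eval (fun j => x j) f) =
      ∑ u ∈ X, w u * MvPolynomial.eval (fun j => u j) f

/-- `A(X_a, X_b)`: the normalized inner products between distinct points of `X_a` and `X_b`.
It is used only for layers with `r_a, r_b ≠ 0`. -/
def angleSet {n p : ℕ} (X : Finset (EuclideanSpace ℝ (Fin n))) (r : Fin p → ℝ) (a b : Fin p) :
    Set ℝ :=
  {α | ∃ x ∈ layer X r a, ∃ y ∈ layer X r b, x ≠ y ∧ inner ℝ x y / (r a * r b) = α}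

/-- `s_{a,b} = |A(X_a, X_b)|`. -/
def angleCount {n p : ℕ} (X : Finset (EuclideanSpace ℝ (Fin n))) (r : Fin p → ℝ) (a b : Fin p) :
    ℕ :=
  (angleSet X r a b).ncard

open Classical in
/-- `ε_S = 1` if `0 ∈ X`, and `ε_S = 0` otherwise. -/
def epsilonS {n : ℕ} (X : Finset (EuclideanSpace ℝ (Fin n))) : ℤ :=
  if (0 : EuclideanSpace ℝ (Fin n)) ∈ X then 1 else 0

/-- `X = -X`. -/
def IsAntipodal {n : ℕ} (X : Finset (EuclideanSpace ℝ (Fin n))) : Prop :=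
  ∀ x ∈ X, -x ∈ X

/-- The pairs `(x, y) ∈ X_a × X_b` with normalized inner product `α`. If `r_a = 0` or `r_b = 0`
the quotient is `0` by convention, so that `X_a × X_b` is the only nonempty relation between
these two layers. -/
def layerRelation {n p : ℕ} (X : Finset (EuclideanSpace ℝ (Fin n))) (r : Fin p → ℝ)
    (a b : Fin p) (α : ℝ) : Set (X × X) :=
  {q | (q.1 : EuclideanSpace ℝ (Fin n)) ∈ layer X r a ∧
    (q.2 : EuclideanSpace ℝ (Fin n)) ∈ layer X r b ∧
    inner ℝ (q.1 : EuclideanSpace ℝ (Fin n)) (q.2 : EuclideanSpace ℝ (Fin n)) / (r a * r b) = α}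

/-- All nonempty relations on `X` given by a pair of layers and a normalized inner product. -/
def layerRelations {n p : ℕ} (X : Finset (EuclideanSpace ℝ (Fin n))) (r : Fin p → ℝ) :
    Set (Set (X × X)) :=
  {R | R.Nonempty ∧ ∃ a b α, R = layerRelation X r a b α}

end EuclideanDesign

/-- A set `𝓡` of relations on a finite set `V` is a coherent configuration (D. G. Higman): it is a
partition of `V × V` into nonempty relations, the diagonal is a union of relations in `𝓡`, the
transpose of a relation in `𝓡` is in `𝓡`, and for `R₁, R₂, R₃ ∈ 𝓡` the number of `z` with
`(x, z) ∈ R₁` and `(z, y) ∈ R₂` is the same for all `(x, y) ∈ R₃`. -/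
structure IsCoherentConfiguration {V : Type*} [Finite V] (𝓡 : Set (Set (V × V))) : Prop where
  partition : Setoid.IsPartition 𝓡
  diagonal : ∃ 𝓓 ⊆ 𝓡, ⋃₀ 𝓓 = Set.diagonal V
  transpose : ∀ R ∈ 𝓡, Prod.swap ⁻¹' R ∈ 𝓡
  intersection_numbers : ∀ R₁ ∈ 𝓡, ∀ R₂ ∈ 𝓡, ∀ R₃ ∈ 𝓡, ∃ c : ℕ, ∀ x y : V, (x, y) ∈ R₃ →
    {z : V | (x, z) ∈ R₁ ∧ (z, y) ∈ R₂}.ncard = c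

end

/-!
Each layer `X_b` of nonzero radius is a spherical design whose strength is `t` lowered by `2` for
each further sphere of nonzero radius. Given a polynomial `f`, apply the cubature formula to
`f · ∏ (‖x‖² - r_i²)`, the product being over those further spheres: the product vanishes on them
and is a nonzero constant on `X_b`, while a layer at the origin contributes equally to both sides
(`IsDesign.sum_layer_eq_mean`).

Fix `x ∈ X_a`, `y ∈ X_c` and normalize all inner products. For polynomials `F`, `G` of small degree,
`∑_{z ∈ X_b} F(⟨x, z⟩) G(⟨z, y⟩)` is therefore `|X_b|` times a mean over a sphere, and by invariance
of the surface measure under isometries it depends on `⟨x, y⟩` only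
(`IsDesign.sum_layer_eval_mul_eval_congr`). The number of `z` with `⟨x, z⟩ = α` and `⟨z, y⟩ = β`
is known directly when `α` or `β` forces `z = ± x` or `z = ± y`: the value `1` within a layer, and
for antipodal `X` also `-1`. By the hypothesis on the `s_{a,b}` the remaining
angles are so few that Lagrange basis polynomials on them are admissible as `F` and `G`, and these
isolate the count for each pair `(α, β)` (`card_filter_eq_of_sum_eval_eq`). If `X_a` is the origin,
the count is the one for the pair `(y, y)`, so the same argument covers it (`jointCount_zero_left`).
-/

namespace EuclideanDesign

/-! ### Invariance of spherical means -/

theorem image_unitSphere_preimage {E : Type*} [NormedAddCommGroup E] [NormedSpace ℝ E]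
    (e : E ≃ₗᵢ[ℝ] E) (g : Metric.sphere (0 : E) 1 → Metric.sphere (0 : E) 1)
    (hg : ∀ u, (g u : E) = e u) (s : Set (Metric.sphere (0 : E) 1)) :
    ((↑) '' (g ⁻¹' s) : Set E) = e ⁻¹' ((↑) '' s) := by
  ext x
  constructor
  · rintro ⟨u, hu, rfl⟩
    exact ⟨g u, hu, hg u⟩
  · rintro ⟨v, hv, hvx⟩
    have hx : x ∈ Metric.sphere (0 : E) 1 := by
      have := v.2
      rw [mem_sphere_zero_iff_norm] at this ⊢
      rw [← e.norm_map, ← hvx, this]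
    refine ⟨⟨x, hx⟩, ?_, rfl⟩
    have : g ⟨x, hx⟩ = v := Subtype.ext (by rw [hg, hvx])
    simpa [this] using hv

open scoped Pointwise in
/-- The surface measure of the unit sphere is invariant under linear isometries: it is the cone
measure, and linear isometries commute with dilations and preserve volume. -/
theorem measurePreserving_toSphere {E : Type*} [NormedAddCommGroup E] [InnerProductSpace ℝ E]
    [FiniteDimensional ℝ E] [MeasurableSpace E] [BorelSpace E]
    (e : E ≃ₗᵢ[ℝ] E) (g : Metric.sphere (0 : E) 1 → Metric.sphere (0 : E) 1)
    (hg : ∀ u, (g u : E) = e u) :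
    MeasurePreserving g (volume : Measure E).toSphere (volume : Measure E).toSphere := by
  have hgc : Continuous g := by
    rw [continuous_induced_rng]
    simpa [Function.comp_def, hg] using e.continuous.comp continuous_subtype_val
  refine ⟨hgc.measurable, Measure.ext fun s hs => ?_⟩
  rw [Measure.map_apply hgc.measurable hs, Measure.toSphere_apply' _ hs,
    Measure.toSphere_apply' _ (hgc.measurable hs), image_unitSphere_preimage e g hg]
  congr 1
  rw [← e.measurePreserving.measure_preimage_equiv (f := e.toMeasurableEquiv)
    (Set.Ioo (0 : ℝ) 1 • ((↑) '' s : Set E))]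
  congr 1
  ext x
  simp only [Set.mem_smul, Set.mem_preimage]
  constructor
  · rintro ⟨c, hc, y, hy, rfl⟩
    exact ⟨c, hc, e y, hy, by simp⟩
  · rintro ⟨c, hc, y, hy, hxy⟩
    refine ⟨c, hc, e.symm y, by simpa using hy, ?_⟩
    apply e.injective
    rw [map_smul, e.apply_symm_apply, hxy]
    rfl

theorem sphereMean_comp_isometry {n : ℕ}
    (e : EuclideanSpace ℝ (Fin n) ≃ₗᵢ[ℝ] EuclideanSpace ℝ (Fin n)) (ρ : ℝ)
    (f : EuclideanSpace ℝ (Fin n) → ℝ) :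
    sphereMean ρ (fun x => f (e x)) = sphereMean ρ f := by
  let g : Metric.sphere (0 : EuclideanSpace ℝ (Fin n)) 1 ≃ₜ
      Metric.sphere (0 : EuclideanSpace ℝ (Fin n)) 1 :=
    { toFun := fun u => ⟨e u, by simp⟩
      invFun := fun u => ⟨e.symm u, by simp⟩
      left_inv := fun u => by simp
      right_inv := fun u => by simp
      continuous_toFun := by fun_prop
      continuous_invFun := by fun_prop }
  have hg := measurePreserving_toSphere e g (fun _ => rfl)
  unfold sphereMean
  rw [average_eq, average_eq,
    ← hg.integral_comp g.measurableEmbedding (fun u => f (ρ • (u : EuclideanSpace ℝ (Fin n))))]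
  simp only [map_smul]
  rfl

theorem sphereMean_const_mul {n : ℕ} (ρ c : ℝ) (f : EuclideanSpace ℝ (Fin n) → ℝ) :
    sphereMean ρ (fun x => c * f x) = c * sphereMean ρ f :=
  integral_const_mul _ _

theorem sphereMean_zero_radius {n : ℕ} (hn : 0 < n) (f : EuclideanSpace ℝ (Fin n) → ℝ) :
    sphereMean 0 f = f 0 := by
  have : Nonempty (Fin n) := ⟨⟨0, hn⟩⟩
  have : NeZero (volume : Measure (EuclideanSpace ℝ (Fin n))).toSphere :=
    ⟨Measure.toSphere_ne_zero _⟩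
  simp only [sphereMean, zero_smul]
  exact average_const _ _

theorem sphereMean_congr {n : ℕ} {ρ : ℝ} (hρ : 0 ≤ ρ) {f g : EuclideanSpace ℝ (Fin n) → ℝ}
    (h : ∀ x, ‖x‖ = ρ → f x = g x) : sphereMean ρ f = sphereMean ρ g := by
  unfold sphereMean
  congr 1
  ext u
  exact h _ (by simp [norm_smul, abs_of_nonneg hρ])

/-- Two pairs of vectors with the same Gram matrix are related by a linear isometry: one reflection
takes `x` to `x'`, and a second one, fixing `x'`, corrects the image of `y`. -/
theorem exists_isometry_map_pair {E : Type*} [NormedAddCommGroup E] [InnerProductSpace ℝ E]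
    {x y x' y' : E} (hx : ‖x‖ = ‖x'‖) (hy : ‖y‖ = ‖y'‖) (hxy : inner ℝ x y = inner ℝ x' y') :
    ∃ e : E ≃ₗᵢ[ℝ] E, e x = x' ∧ e y = y' := by
  set e₁ : E ≃ₗᵢ[ℝ] E := (ℝ ∙ (x - x'))ᗮ.reflection with he₁
  have h₁ : e₁ x = x' := Submodule.reflection_sub hx
  set e₂ : E ≃ₗᵢ[ℝ] E := (ℝ ∙ (e₁ y - y'))ᗮ.reflection with he₂
  have h₂ : e₂ (e₁ y) = y' := Submodule.reflection_sub (by rw [e₁.norm_map, hy])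
  refine ⟨e₁.trans e₂, ?_, h₂⟩
  simp only [LinearIsometryEquiv.trans_apply, h₁]
  apply Submodule.reflection_mem_subspace_eq_self
  rw [Submodule.mem_orthogonal_singleton_iff_inner_left, inner_sub_right, ← hxy, ← h₁,
    e₁.inner_map_map, sub_self]

/-- The mean over a sphere of a function of the inner products with two fixed vectors depends only
on the Gram matrix of these vectors. -/
theorem sphereMean_inner_inner_congr {n : ℕ} (ρ : ℝ) {x y x' y' : EuclideanSpace ℝ (Fin n)}
    (hx : ‖x‖ = ‖x'‖) (hy : ‖y‖ = ‖y'‖) (hxy : inner ℝ x y = inner ℝ x' y') (H : ℝ → ℝ → ℝ) :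
    sphereMean ρ (fun z => H (inner ℝ x z) (inner ℝ z y)) =
      sphereMean ρ (fun z => H (inner ℝ x' z) (inner ℝ z y')) := by
  obtain ⟨e, rfl, rfl⟩ := exists_isometry_map_pair hx hy hxy
  have h := sphereMean_comp_isometry e ρ (fun z => H (inner ℝ (e x) z) (inner ℝ z (e y)))
  simpa only [e.inner_map_map] using h

/-! ### The layers are spherical designs -/

theorem mem_layer {n p : ℕ} {X : Finset (EuclideanSpace ℝ (Fin n))} {r : Fin p → ℝ} {i : Fin p}
    {x : EuclideanSpace ℝ (Fin n)} : x ∈ layer X r i ↔ x ∈ X ∧ ‖x‖ = r i :=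
  Finset.mem_filter

theorem IsSupportedBy.radius_nonneg {n p : ℕ} {X : Finset (EuclideanSpace ℝ (Fin n))}
    {r : Fin p → ℝ} (h : IsSupportedBy X r) (i : Fin p) : 0 ≤ r i := by
  obtain ⟨x, hx⟩ := h.layer_nonempty i
  rw [← (mem_layer.1 hx).2]
  exact norm_nonneg x

theorem IsSupportedBy.sum_layers {n p : ℕ} {X : Finset (EuclideanSpace ℝ (Fin n))}
    {r : Fin p → ℝ} (h : IsSupportedBy X r) (f : EuclideanSpace ℝ (Fin n) → ℝ) :
    ∑ x ∈ X, f x = ∑ i, ∑ x ∈ layer X r i, f x := by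
  classical
  have hX : X = Finset.univ.biUnion (layer X r) := by
    ext x
    simp only [Finset.mem_biUnion, Finset.mem_univ, true_and, mem_layer]
    exact ⟨fun hx => (h.cover x hx).imp fun _ hi => ⟨hx, hi⟩, fun ⟨_, hx, _⟩ => hx⟩
  conv_lhs => rw [hX]
  refine Finset.sum_biUnion fun i _ j _ hij => Finset.disjoint_left.2 fun x hi hj => hij ?_
  exact h.radii_injective ((mem_layer.1 hi).2.symm.trans (mem_layer.1 hj).2)

/-- The squared norm minus a constant, as a polynomial in the coordinates. -/
noncomputable def normSqSub (n : ℕ) (c : ℝ) : MvPolynomial (Fin n) ℝ :=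
  ∑ j, MvPolynomial.X j ^ 2 - MvPolynomial.C c

theorem eval_normSqSub {n : ℕ} (c : ℝ) (x : EuclideanSpace ℝ (Fin n)) :
    MvPolynomial.eval (fun j => x j) (normSqSub n c) = ‖x‖ ^ 2 - c := by
  simp [normSqSub, EuclideanSpace.norm_sq_eq]

theorem totalDegree_normSqSub_le (n : ℕ) (c : ℝ) : (normSqSub n c).totalDegree ≤ 2 := by
  refine (MvPolynomial.totalDegree_sub _ _).trans (max_le ?_ (by simp))
  exact MvPolynomial.totalDegree_finsetSum_le fun j _ => by simp

/-- Each layer averages the polynomials of degree at most `t - 2 m`, where `m` is the number of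
other spheres of nonzero radius. Multiplying `f` by the product of the polynomials
`‖x‖² - r_i²` over these spheres kills their contributions to the cubature formula, and the
contributions of the sphere of radius `0` to both sides agree. -/
theorem IsDesign.sum_layer_eq_mean {n p t : ℕ} (hn : 0 < n)
    {X : Finset (EuclideanSpace ℝ (Fin n))} {w : EuclideanSpace ℝ (Fin n) → ℝ} {r : Fin p → ℝ}
    (hX : IsDesign t X w r) {b : Fin p} {c : ℝ} (hw : ∀ x ∈ layer X r b, w x = c)
    (f : MvPolynomial (Fin n) ℝ)
    (hf : f.totalDegree + 2 * (Finset.univ.filter fun i => i ≠ b ∧ r i ≠ 0).card ≤ t) :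
    ∑ z ∈ layer X r b, MvPolynomial.eval (fun j => z j) f =
      (layer X r b).card * sphereMean (r b) (fun z => MvPolynomial.eval (fun j => z j) f) := by
  classical
  set K := Finset.univ.filter fun i => i ≠ b ∧ r i ≠ 0 with hK
  set h : MvPolynomial (Fin n) ℝ := f * ∏ i ∈ K, normSqSub n (r i ^ 2) with hh
  have hdeg : h.totalDegree ≤ t := by
    refine (MvPolynomial.totalDegree_mul _ _).trans (le_trans ?_ hf)
    gcongr
    refine (MvPolynomial.totalDegree_finsetProd _ _).trans ?_
    refine (Finset.sum_le_card_nsmul _ _ 2 fun i _ => totalDegree_normSqSub_le n _).trans ?_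
    simp [mul_comm]
  have heval : ∀ x : EuclideanSpace ℝ (Fin n), MvPolynomial.eval (fun j => x j) h =
      (∏ i ∈ K, (‖x‖ ^ 2 - r i ^ 2)) * MvPolynomial.eval (fun j => x j) f := by
    intro x
    simp only [hh, map_mul, map_prod, eval_normSqSub]
    ring
  have hcub := hX.cubature h hdeg
  rw [hX.supported.sum_layers, ← sub_eq_zero, ← Finset.sum_sub_distrib,
    Finset.sum_eq_single b ?_ (by simp)] at hcub
  · set d := ∏ i ∈ K, (r b ^ 2 - r i ^ 2)
    have hd : d ≠ 0 := by
      refine Finset.prod_ne_zero_iff.2 fun i hi h0 => ?_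
      have hib := (Finset.mem_filter.1 hi).2.1
      refine hib (hX.supported.radii_injective ?_).symm
      exact (sq_eq_sq₀ (hX.supported.radius_nonneg b) (hX.supported.radius_nonneg i)).1
        (sub_eq_zero.1 h0)
    obtain ⟨x₀, hx₀⟩ := hX.supported.layer_nonempty b
    have hc : c ≠ 0 := by
      rw [← hw x₀ hx₀]
      exact (hX.weight_pos x₀ (mem_layer.1 hx₀).1).ne'
    have hmean : sphereMean (r b) (fun x => MvPolynomial.eval (fun j => x j) h) =
        d * sphereMean (r b) (fun x => MvPolynomial.eval (fun j => x j) f) := by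
      rw [← sphereMean_const_mul]
      exact sphereMean_congr (hX.supported.radius_nonneg b) fun x hx => by rw [heval, hx]
    have hsum : ∑ x ∈ layer X r b, w x * MvPolynomial.eval (fun j => x j) h =
        c * d * ∑ x ∈ layer X r b, MvPolynomial.eval (fun j => x j) f := by
      rw [Finset.mul_sum]
      exact Finset.sum_congr rfl fun x hx => by rw [hw x hx, heval, (mem_layer.1 hx).2, mul_assoc]
    rw [hmean, hsum, Finset.sum_congr rfl hw, Finset.sum_const, nsmul_eq_mul] at hcub
    apply mul_left_cancel₀ (mul_ne_zero hc hd)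
    linear_combination -hcub
  · intro i _ hib
    by_cases hi : r i = 0
    · rw [hi, sphereMean_zero_radius hn, Finset.sum_mul, sub_eq_zero]
      refine Finset.sum_congr rfl fun x hx => ?_
      rw [norm_eq_zero.1 ((mem_layer.1 hx).2.trans hi)]
    · have hvanish : ∀ x : EuclideanSpace ℝ (Fin n), ‖x‖ = r i →
          MvPolynomial.eval (fun j => x j) h = 0 := by
        intro x hx
        rw [heval, hx, Finset.prod_eq_zero (i := i) (by simp [hK, hib, hi]) (sub_self _), zero_mul]
      have hmean : sphereMean (r i) (fun x => MvPolynomial.eval (fun j => x j) h) = 0 := by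
        rw [sphereMean_congr (g := fun _ => 0) (hX.supported.radius_nonneg i) hvanish]
        simp [sphereMean]
      have hsum : ∑ x ∈ layer X r i, w x * MvPolynomial.eval (fun j => x j) h = 0 :=
        Finset.sum_eq_zero fun x hx => by rw [hvanish x (mem_layer.1 hx).2, mul_zero]
      rw [hmean, hsum, mul_zero, sub_zero]

/-- The inner product with `x`, divided by `ρ`, as a linear form in the coordinates. -/
noncomputable def innerForm {n : ℕ} (x : EuclideanSpace ℝ (Fin n)) (ρ : ℝ) :
    MvPolynomial (Fin n) ℝ :=
  ∑ j, MvPolynomial.C (x j / ρ) * MvPolynomial.X j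

theorem eval_innerForm {n : ℕ} (x z : EuclideanSpace ℝ (Fin n)) (ρ : ℝ) :
    MvPolynomial.eval (fun j => z j) (innerForm x ρ) = inner ℝ x z / ρ := by
  simp only [innerForm, map_sum, map_mul, MvPolynomial.eval_C, MvPolynomial.eval_X,
    PiLp.inner_apply, Finset.sum_div]
  exact Finset.sum_congr rfl fun j _ => by simp; ring

theorem totalDegree_innerForm_le {n : ℕ} (x : EuclideanSpace ℝ (Fin n)) (ρ : ℝ) :
    (innerForm x ρ).totalDegree ≤ 1 :=
  MvPolynomial.totalDegree_finsetSum_le fun j _ =>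
    (MvPolynomial.totalDegree_mul _ _).trans (by simp)

theorem totalDegree_aeval_le {n : ℕ} (F : Polynomial ℝ) {P : MvPolynomial (Fin n) ℝ}
    (hP : P.totalDegree ≤ 1) : (Polynomial.aeval P F).totalDegree ≤ F.natDegree := by
  rw [Polynomial.aeval_eq_sum_range]
  refine MvPolynomial.totalDegree_finsetSum_le fun i hi => ?_
  refine (MvPolynomial.totalDegree_smul_le _ _).trans ((MvPolynomial.totalDegree_pow _ _).trans ?_)
  have := Finset.mem_range_succ_iff.1 hi
  nlinarith

theorem eval_aeval_innerForm {n : ℕ} (F : Polynomial ℝ) (x z : EuclideanSpace ℝ (Fin n)) (ρ : ℝ) :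
    MvPolynomial.eval (fun j => z j) (Polynomial.aeval (innerForm x ρ) F) =
      F.eval (inner ℝ x z / ρ) := by
  rw [Polynomial.aeval_def, Polynomial.hom_eval₂, eval_innerForm, Polynomial.eval]
  congr 1
  ext a
  simp

/-- The sums `∑ z, F(⟨x, z⟩) G(⟨z, y⟩)` over a layer depend on the Gram matrix of `x` and `y` only,
provided that the degrees of `F` and `G` are small enough for the layer to be averaged exactly. -/
theorem IsDesign.sum_layer_eval_mul_eval_congr {n p t : ℕ} (hn : 0 < n)
    {X : Finset (EuclideanSpace ℝ (Fin n))} {w : EuclideanSpace ℝ (Fin n) → ℝ} {r : Fin p → ℝ}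
    (hX : IsDesign t X w r) {b : Fin p}
    (hw : ∃ c : ℝ, ∀ x ∈ layer X r b, w x = c) (F G : Polynomial ℝ)
    (hFG : F.natDegree + G.natDegree +
      2 * (Finset.univ.filter fun i => i ≠ b ∧ r i ≠ 0).card ≤ t) (ρ σ : ℝ)
    {x y x' y' : EuclideanSpace ℝ (Fin n)}
    (hx : ‖x‖ = ‖x'‖) (hy : ‖y‖ = ‖y'‖) (hxy : inner ℝ x y = inner ℝ x' y') :
    ∑ z ∈ layer X r b, F.eval (inner ℝ x z / ρ) * G.eval (inner ℝ z y / σ) =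
      ∑ z ∈ layer X r b, F.eval (inner ℝ x' z / ρ) * G.eval (inner ℝ z y' / σ) := by
  obtain ⟨c, hc⟩ := hw
  have key : ∀ x y : EuclideanSpace ℝ (Fin n),
      ∑ z ∈ layer X r b, F.eval (inner ℝ x z / ρ) * G.eval (inner ℝ z y / σ) =
        (layer X r b).card *
          sphereMean (r b) (fun z => F.eval (inner ℝ x z / ρ) * G.eval (inner ℝ z y / σ)) := by
    intro x y
    have h := hX.sum_layer_eq_mean hn hc
      (Polynomial.aeval (innerForm x ρ) F * Polynomial.aeval (innerForm y σ) G) (by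
        refine le_trans ?_ hFG
        gcongr
        exact (MvPolynomial.totalDegree_mul _ _).trans (add_le_add
          (totalDegree_aeval_le F (totalDegree_innerForm_le x ρ))
          (totalDegree_aeval_le G (totalDegree_innerForm_le y σ))))
    simpa only [map_mul, eval_aeval_innerForm, real_inner_comm] using h
  rw [key, key, sphereMean_inner_inner_congr (r b) hx hy hxy
    (fun u v => F.eval (u / ρ) * G.eval (v / σ))]

/-! ### Interpolation on the angles -/

/-- The joint distribution of a pair of functions `(u, v)` on a finite set is determined by the sums
of `F(u) G(v)` for polynomials of degrees `|A| - 1` and `|B| - 1`, once it is known outside of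
`A × B`: Lagrange interpolation isolates each pair in `A × B`. -/
theorem card_filter_eq_of_sum_eval_eq {ι : Type*} (S : Finset ι) (u v u' v' : ι → ℝ)
    (A B : Finset ℝ)
    (hA : ∀ α ∉ A, ∀ β, (S.filter fun z => u z = α ∧ v z = β).card =
      (S.filter fun z => u' z = α ∧ v' z = β).card)
    (hB : ∀ α, ∀ β ∉ B, (S.filter fun z => u z = α ∧ v z = β).card =
      (S.filter fun z => u' z = α ∧ v' z = β).card)
    (hsum : ∀ F G : Polynomial ℝ, F.natDegree + 1 = A.card → G.natDegree + 1 = B.card →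
      ∑ z ∈ S, F.eval (u z) * G.eval (v z) = ∑ z ∈ S, F.eval (u' z) * G.eval (v' z))
    (α β : ℝ) :
    (S.filter fun z => u z = α ∧ v z = β).card = (S.filter fun z => u' z = α ∧ v' z = β).card := by
  classical
  by_cases hα : α ∈ A
  swap
  · exact hA α hα β
  by_cases hβ : β ∈ B
  swap
  · exact hB α β hβ
  have hdeg : ∀ (C : Finset ℝ) (γ : ℝ), γ ∈ C → (Lagrange.basis C id γ).natDegree + 1 = C.card := by
    intro C γ hγ
    rw [Lagrange.natDegree_basis (Set.injOn_id _) hγ]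
    exact Nat.sub_add_cancel (Finset.card_pos.2 ⟨γ, hγ⟩)
  have hself : ∀ (C : Finset ℝ) (γ : ℝ), γ ∈ C → (Lagrange.basis C id γ).eval γ = 1 :=
    fun C γ hγ => Lagrange.eval_basis_self (v := id) (Set.injOn_id _) hγ
  have hne : ∀ (C : Finset ℝ) (γ δ : ℝ), γ ≠ δ → δ ∈ C → (Lagrange.basis C id γ).eval δ = 0 :=
    fun C γ δ hγδ hδ => Lagrange.eval_basis_of_ne (v := id) hγδ hδ
  set F := Lagrange.basis A id α
  set G := Lagrange.basis B id β
  set T := S.image (fun z => (u z, v z)) ∪ S.image (fun z => (u' z, v' z))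
  have hfib : ∀ f g : ι → ℝ, (∀ z ∈ S, (f z, g z) ∈ T) →
      ∑ z ∈ S, F.eval (f z) * G.eval (g z) =
        ∑ q ∈ T, ((S.filter fun z => f z = q.1 ∧ g z = q.2).card : ℝ) *
          (F.eval q.1 * G.eval q.2) := by
    intro f g hfg
    rw [← Finset.sum_fiberwise_of_maps_to hfg]
    refine Finset.sum_congr rfl fun q _ => ?_
    rw [Finset.filter_congr (q := fun z => f z = q.1 ∧ g z = q.2) fun z _ => Prod.ext_iff]
    rw [← nsmul_eq_mul, ← Finset.sum_const]
    refine Finset.sum_congr rfl fun z hz => ?_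
    obtain ⟨h₁, h₂⟩ := (Finset.mem_filter.1 hz).2
    rw [h₁, h₂]
  have h := hsum F G (hdeg A α hα) (hdeg B β hβ)
  rw [hfib u v fun z hz => Finset.mem_union_left _ (Finset.mem_image_of_mem _ hz),
    hfib u' v' fun z hz => Finset.mem_union_right _ (Finset.mem_image_of_mem _ hz),
    ← sub_eq_zero, ← Finset.sum_sub_distrib] at h
  by_cases hT : (α, β) ∈ T
  · rw [Finset.sum_eq_single_of_mem _ hT ?_] at h
    · rw [hself A α hα, hself B β hβ, mul_one, mul_one, mul_one, sub_eq_zero] at h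
      exact_mod_cast h
    · rintro ⟨γ, δ⟩ _ hq
      by_cases hγ : γ ∈ A
      swap
      · rw [hA γ hγ δ, sub_self]
      by_cases hδ : δ ∈ B
      swap
      · rw [hB γ δ hδ, sub_self]
      by_cases hαγ : α = γ
      · have hβδ : β ≠ δ := by
          rintro rfl
          exact hq (by rw [hαγ])
        simp [G, hne B β δ hβδ hδ]
      · simp [F, hne A α γ hαγ hγ]
  · have hempty : ∀ f g : ι → ℝ, (∀ z ∈ S, (f z, g z) ∈ T) →
        (S.filter fun z => f z = α ∧ g z = β).card = 0 := by
      intro f g hfg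
      rw [Finset.card_eq_zero, Finset.filter_eq_empty_iff]
      rintro z hz ⟨rfl, rfl⟩
      exact hT (hfg z hz)
    rw [hempty u v fun z hz => Finset.mem_union_left _ (Finset.mem_image_of_mem _ hz),
      hempty u' v' fun z hz => Finset.mem_union_right _ (Finset.mem_image_of_mem _ hz)]

section Angles

variable {n p : ℕ} {X : Finset (EuclideanSpace ℝ (Fin n))} {r : Fin p → ℝ}

/-- The number of `z ∈ X_b` with normalized inner products `α` with `x` and `β` with `y`, where
`x` and `y` are meant to lie in `X_a` and `X_c`. -/
noncomputable def jointCount (X : Finset (EuclideanSpace ℝ (Fin n))) (r : Fin p → ℝ)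
    (a b c : Fin p) (α β : ℝ) (x y : EuclideanSpace ℝ (Fin n)) : ℕ :=
  ((layer X r b).filter fun z =>
    inner ℝ x z / (r a * r b) = α ∧ inner ℝ z y / (r b * r c) = β).card

theorem jointCount_swap (a b c : Fin p) (α β : ℝ) (x y : EuclideanSpace ℝ (Fin n)) :
    jointCount X r a b c α β x y = jointCount X r c b a β α y x := by
  unfold jointCount
  congr 1
  refine Finset.filter_congr fun z _ => ?_
  rw [real_inner_comm x z, real_inner_comm z y, mul_comm (r a), mul_comm (r b) (r c), and_comm]

/-- A normalized inner product `α` is trivial for the layers `X_a` and `X_b` if it does not occur,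
or if `z ∈ X_b` makes it with `x ∈ X_a` exactly when `z = ε x`, for a fixed scalar `ε`. -/
def IsTrivialAngle (X : Finset (EuclideanSpace ℝ (Fin n))) (r : Fin p → ℝ) (a b : Fin p)
    (α : ℝ) : Prop :=
  (∀ x ∈ layer X r a, ∀ z ∈ layer X r b, inner ℝ x z / (r a * r b) ≠ α) ∨
    ∃ ε : ℝ, ∀ x ∈ layer X r a, ε • x ∈ layer X r b ∧
      ∀ z ∈ layer X r b, inner ℝ x z / (r a * r b) = α ↔ z = ε • x

theorem IsTrivialAngle.jointCount_congr {a b : Fin p} {α : ℝ} (hα : IsTrivialAngle X r a b α)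
    (c : Fin p) (β : ℝ) {x y x' y' : EuclideanSpace ℝ (Fin n)} (hx : x ∈ layer X r a)
    (hx' : x' ∈ layer X r a) (hxy : inner ℝ x y = inner ℝ x' y') :
    jointCount X r a b c α β x y = jointCount X r a b c α β x' y' := by
  classical
  rcases hα with hα | ⟨ε, hε⟩
  · have h0 : ∀ x ∈ layer X r a, ∀ y, jointCount X r a b c α β x y = 0 := by
      intro x hx y
      rw [jointCount, Finset.card_eq_zero, Finset.filter_eq_empty_iff]
      exact fun z hz h => hα x hx z hz h.1
    rw [h0 x hx, h0 x' hx']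
  · have h1 : ∀ x ∈ layer X r a, ∀ y, jointCount X r a b c α β x y =
        if ε * inner ℝ x y / (r b * r c) = β then 1 else 0 := by
      intro x hx y
      obtain ⟨hmem, hiff⟩ := hε x hx
      have hset : ((layer X r b).filter fun z =>
          inner ℝ x z / (r a * r b) = α ∧ inner ℝ z y / (r b * r c) = β) =
          if ε * inner ℝ x y / (r b * r c) = β then {ε • x} else ∅ := by
        ext z
        rw [Finset.mem_filter]
        constructor
        · rintro ⟨hz, h₁, h₂⟩
          obtain rfl := (hiff z hz).1 h₁
          rw [real_inner_smul_left] at h₂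
          rw [if_pos h₂, Finset.mem_singleton]
        · split_ifs with h
          · rw [Finset.mem_singleton]
            rintro rfl
            exact ⟨hmem, (hiff _ hmem).2 rfl, by rw [real_inner_smul_left, h]⟩
          · simp
      rw [jointCount, hset]
      split_ifs <;> simp
    rw [h1 x hx, h1 x' hx', hxy]

theorem inner_div_eq_one_iff {a : Fin p} (ha : r a ≠ 0) {x z : EuclideanSpace ℝ (Fin n)}
    (hx : x ∈ layer X r a) (hz : z ∈ layer X r a) :
    inner ℝ x z / (r a * r a) = 1 ↔ z = x := by
  rw [div_eq_one_iff_eq (mul_ne_zero ha ha), eq_comm (a := z), ← sub_eq_zero (a := x),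
    ← norm_eq_zero, ← sq_eq_zero_iff, norm_sub_sq_real, (mem_layer.1 hx).2, (mem_layer.1 hz).2]
  constructor <;> intro h <;> linarith

theorem inner_div_eq_neg_one_iff {a : Fin p} (ha : r a ≠ 0) {x z : EuclideanSpace ℝ (Fin n)}
    (hx : x ∈ layer X r a) (hz : z ∈ layer X r a) :
    inner ℝ x z / (r a * r a) = -1 ↔ z = -x := by
  rw [div_eq_iff (mul_ne_zero ha ha), eq_neg_iff_add_eq_zero, add_comm,
    ← norm_eq_zero, ← sq_eq_zero_iff, norm_add_sq_real, (mem_layer.1 hx).2, (mem_layer.1 hz).2]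
  constructor <;> intro h <;> linarith

theorem isTrivialAngle_one {a : Fin p} (ha : r a ≠ 0) : IsTrivialAngle X r a a 1 :=
  Or.inr ⟨1, fun x hx => ⟨by rwa [one_smul], fun z hz => by
    rw [one_smul, inner_div_eq_one_iff ha hx hz]⟩⟩

theorem neg_mem_layer (hX : IsAntipodal X) {a : Fin p} {x : EuclideanSpace ℝ (Fin n)}
    (hx : x ∈ layer X r a) : -x ∈ layer X r a := by
  rw [mem_layer] at hx ⊢
  exact ⟨hX x hx.1, by rw [norm_neg, hx.2]⟩

theorem isTrivialAngle_neg_one (hX : IsAntipodal X) {a : Fin p} (ha : r a ≠ 0) :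
    IsTrivialAngle X r a a (-1) :=
  Or.inr ⟨-1, fun x hx => ⟨by rw [neg_one_smul]; exact neg_mem_layer hX hx, fun z hz => by
    rw [neg_one_smul, inner_div_eq_neg_one_iff ha hx hz]⟩⟩

open Classical in
/-- The normalized inner products between `X_a` and `X_b` that are not trivial. -/
noncomputable def nontrivialAngles (X : Finset (EuclideanSpace ℝ (Fin n))) (r : Fin p → ℝ)
    (a b : Fin p) : Finset ℝ :=
  ((layer X r a ×ˢ layer X r b).image fun q => inner ℝ q.1 q.2 / (r a * r b)).filter
    fun α => ¬ IsTrivialAngle X r a b α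

theorem isTrivialAngle_of_notMem {a b : Fin p} {α : ℝ} (h : α ∉ nontrivialAngles X r a b) :
    IsTrivialAngle X r a b α := by
  classical
  by_contra hα
  refine hα (Or.inl fun x hx z hz hxz => h ?_)
  exact Finset.mem_filter.2 ⟨Finset.mem_image.2 ⟨(x, z), Finset.mk_mem_product hx hz, hxz⟩, hα⟩

theorem nontrivialAngles_subset_angleSet (hr : Function.Injective r) {a b : Fin p} (ha : r a ≠ 0) :
    (nontrivialAngles X r a b : Set ℝ) ⊆ angleSet X r a b := by
  classical
  intro α hα
  obtain ⟨hα, hα'⟩ := Finset.mem_filter.1 hα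
  obtain ⟨⟨x, z⟩, hq, rfl⟩ := Finset.mem_image.1 hα
  obtain ⟨hx, hz⟩ := Finset.mem_product.1 hq
  refine ⟨x, hx, z, hz, ?_, rfl⟩
  rintro rfl
  obtain rfl : a = b := hr ((mem_layer.1 hx).2.symm.trans (mem_layer.1 hz).2)
  dsimp only at hα'
  rw [(inner_div_eq_one_iff ha hx hz).2 rfl] at hα'
  exact hα' (isTrivialAngle_one ha)

theorem finite_angleSet (a b : Fin p) : (angleSet X r a b).Finite := by
  refine ((layer X r a ×ˢ layer X r b).finite_toSet.image
    fun q => inner ℝ q.1 q.2 / (r a * r b)).subset ?_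
  rintro α ⟨x, hx, z, hz, -, rfl⟩
  exact ⟨(x, z), Finset.mk_mem_product hx hz, rfl⟩

theorem angleCount_comm (a b : Fin p) : angleCount X r a b = angleCount X r b a := by
  have h : ∀ a b, angleSet X r a b ⊆ angleSet X r b a := by
    rintro a b α ⟨x, hx, z, hz, hne, rfl⟩
    exact ⟨z, hz, x, hx, hne.symm, by rw [real_inner_comm, mul_comm (r a)]⟩
  unfold angleCount
  rw [(h a b).antisymm (h b a)]

theorem card_nontrivialAngles_le (hr : Function.Injective r) {a : Fin p} (ha : r a ≠ 0)
    (b : Fin p) : (nontrivialAngles X r a b).card ≤ angleCount X r a b := by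
  rw [← Set.ncard_coe_finset]
  exact Set.ncard_le_ncard (nontrivialAngles_subset_angleSet hr ha) (finite_angleSet a b)

/-- In an antipodal set, the normalized inner product `-1` within a layer occurs and is trivial. -/
theorem card_nontrivialAngles_add_le (hX : IsAntipodal X) (hXr : IsSupportedBy X r) {a : Fin p}
    (ha : r a ≠ 0) (b : Fin p) :
    (nontrivialAngles X r a b).card + (if a = b then 1 else 0) ≤ angleCount X r a b := by
  classical
  split_ifs with hab
  · subst hab
    obtain ⟨x, hx⟩ := hXr.layer_nonempty a
    have hx' := neg_mem_layer hX hx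
    have hmem : (-1 : ℝ) ∈ angleSet X r a a := by
      refine ⟨x, hx, -x, hx', ?_, (inner_div_eq_neg_one_iff ha hx hx').2 rfl⟩
      intro h
      have h₁ := (inner_div_eq_one_iff ha hx hx).2 rfl
      have h₂ := (inner_div_eq_neg_one_iff ha hx hx).2 h
      linarith
    have hsub : (nontrivialAngles X r a a : Set ℝ) ⊆ angleSet X r a a \ {-1} := by
      intro α hα
      refine ⟨nontrivialAngles_subset_angleSet hXr.radii_injective ha hα, ?_⟩
      rintro rfl
      exact (Finset.mem_filter.1 hα).2 (isTrivialAngle_neg_one hX ha)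
    rw [← Set.ncard_coe_finset, angleCount, ← Set.ncard_sdiff_singleton_add_one hmem
      (finite_angleSet a a)]
    gcongr
    exact (finite_angleSet a a).sdiff
  · exact card_nontrivialAngles_le hXr.radii_injective ha b

/-! ### Intersection numbers -/

theorem IsDesign.jointCount_congr_of_radii_ne_zero {t : ℕ} (hn : 0 < n)
    {w : EuclideanSpace ℝ (Fin n) → ℝ} (hX : IsDesign t X w r) {a b c : Fin p}
    (hw : ∃ d : ℝ, ∀ x ∈ layer X r b, w x = d) (ha : r a ≠ 0) (hc : r c ≠ 0)
    (hcard : (nontrivialAngles X r a b).card + (nontrivialAngles X r c b).card +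
      2 * (Finset.univ.filter fun i => i ≠ b ∧ r i ≠ 0).card ≤ t + 2)
    (α β : ℝ) {x y x' y' : EuclideanSpace ℝ (Fin n)}
    (hx : x ∈ layer X r a) (hx' : x' ∈ layer X r a)
    (hy : y ∈ layer X r c) (hy' : y' ∈ layer X r c)
    (hxy : inner ℝ x y / (r a * r c) = inner ℝ x' y' / (r a * r c)) :
    jointCount X r a b c α β x y = jointCount X r a b c α β x' y' := by
  replace hxy : inner ℝ x y = inner ℝ x' y' :=
    (div_left_inj' (mul_ne_zero ha hc)).1 hxy
  refine card_filter_eq_of_sum_eval_eq _ _ _ _ _ (nontrivialAngles X r a b)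
    (nontrivialAngles X r c b) ?_ ?_ ?_ α β
  · exact fun α hα β => (isTrivialAngle_of_notMem hα).jointCount_congr c β hx hx' hxy
  · intro α β hβ
    have h := (isTrivialAngle_of_notMem hβ).jointCount_congr a α hy hy'
      (by rw [real_inner_comm, hxy, real_inner_comm])
    rwa [jointCount_swap c, jointCount_swap c] at h
  · intro F G hF hG
    exact hX.sum_layer_eval_mul_eval_congr hn hw F G (by omega) _ _
      ((mem_layer.1 hx).2.trans (mem_layer.1 hx').2.symm)
      ((mem_layer.1 hy).2.trans (mem_layer.1 hy').2.symm) hxy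

theorem eq_zero_of_mem_layer {a : Fin p} (ha : r a = 0) {x : EuclideanSpace ℝ (Fin n)}
    (hx : x ∈ layer X r a) : x = 0 :=
  norm_eq_zero.1 ((mem_layer.1 hx).2.trans ha)

/-- Counting from the centre: only the inner product with `y` matters, and the count equals the one
for the pair `(y, y)`. -/
theorem jointCount_zero_left (a b c : Fin p) (α β : ℝ) (y : EuclideanSpace ℝ (Fin n)) :
    jointCount X r a b c α β 0 y = if α = 0 then jointCount X r c b c β β y y else 0 := by
  unfold jointCount
  split_ifs with hα
  · congr 1
    refine Finset.filter_congr fun z _ => ?_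
    rw [inner_zero_left, zero_div, real_inner_comm, mul_comm (r c)]
    simp [hα]
  · rw [Finset.card_eq_zero, Finset.filter_eq_empty_iff]
    rintro z - ⟨h, -⟩
    rw [inner_zero_left, zero_div] at h
    exact hα h.symm

/-- The counts depend only on the relation containing `(x, y)`, also when some radii are `0`. -/
theorem IsDesign.jointCount_congr {t : ℕ} (hn : 0 < n)
    {w : EuclideanSpace ℝ (Fin n) → ℝ} (hX : IsDesign t X w r)
    (hw : ∀ i : Fin p, ∃ c : ℝ, ∀ x ∈ layer X r i, w x = c)
    (hcard : ∀ a b c, r a ≠ 0 → r b ≠ 0 → r c ≠ 0 →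
      (nontrivialAngles X r a b).card + (nontrivialAngles X r c b).card +
        2 * (Finset.univ.filter fun i => i ≠ b ∧ r i ≠ 0).card ≤ t + 2)
    {a b c : Fin p} (α β : ℝ) {x y x' y' : EuclideanSpace ℝ (Fin n)}
    (hx : x ∈ layer X r a) (hx' : x' ∈ layer X r a)
    (hy : y ∈ layer X r c) (hy' : y' ∈ layer X r c)
    (hxy : inner ℝ x y / (r a * r c) = inner ℝ x' y' / (r a * r c)) :
    jointCount X r a b c α β x y = jointCount X r a b c α β x' y' := by
  by_cases hb : r b = 0
  · unfold jointCount
    congr 1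
    refine Finset.filter_congr fun z hz => ?_
    simp [eq_zero_of_mem_layer hb hz]
  -- The counts for `(y, y)` agree because `y` and `y'` have the same norm.
  have hself : ∀ {c : Fin p} {y y' : EuclideanSpace ℝ (Fin n)} (β : ℝ), r c ≠ 0 →
      y ∈ layer X r c → y' ∈ layer X r c →
      jointCount X r c b c β β y y = jointCount X r c b c β β y' y' := by
    intro c y y' β hc hy hy'
    refine hX.jointCount_congr_of_radii_ne_zero hn (hw b) hc hc (hcard c b c hc hb hc) β β
      hy hy' hy hy' ?_
    rw [(inner_div_eq_one_iff hc hy hy).2 rfl, (inner_div_eq_one_iff hc hy' hy').2 rfl]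
  by_cases ha : r a = 0
  · obtain rfl := eq_zero_of_mem_layer ha hx
    obtain rfl := eq_zero_of_mem_layer ha hx'
    by_cases hc : r c = 0
    · rw [eq_zero_of_mem_layer hc hy, eq_zero_of_mem_layer hc hy']
    · rw [jointCount_zero_left, jointCount_zero_left, hself β hc hy hy']
  by_cases hc : r c = 0
  · obtain rfl := eq_zero_of_mem_layer hc hy
    obtain rfl := eq_zero_of_mem_layer hc hy'
    rw [jointCount_swap a, jointCount_swap a, jointCount_zero_left, jointCount_zero_left,
      hself α ha hx hx']
  exact hX.jointCount_congr_of_radii_ne_zero hn (hw b) ha hc (hcard a b c ha hb hc) α β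
    hx hx' hy hy' hxy

/-! ### The coherent configuration -/

theorem mem_layerRelation {a b : Fin p} {α : ℝ} {x y : X} :
    (x, y) ∈ layerRelation X r a b α ↔ (x : EuclideanSpace ℝ (Fin n)) ∈ layer X r a ∧
      (y : EuclideanSpace ℝ (Fin n)) ∈ layer X r b ∧
      inner ℝ (x : EuclideanSpace ℝ (Fin n)) y / (r a * r b) = α :=
  Iff.rfl

theorem swap_preimage_layerRelation (a b : Fin p) (α : ℝ) :
    Prod.swap ⁻¹' layerRelation X r a b α = layerRelation X r b a α := by
  ext ⟨x, y⟩
  rw [Set.mem_preimage, Prod.swap_prod_mk, mem_layerRelation, mem_layerRelation, real_inner_comm,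
    mul_comm (r a)]
  tauto

theorem eq_of_mem_layer (hr : Function.Injective r) {a b : Fin p} {x : EuclideanSpace ℝ (Fin n)}
    (ha : x ∈ layer X r a) (hb : x ∈ layer X r b) : a = b :=
  hr ((mem_layer.1 ha).2.symm.trans (mem_layer.1 hb).2)

theorem IsSupportedBy.exists_mem_layer (h : IsSupportedBy X r) (x : X) :
    ∃ a, (x : EuclideanSpace ℝ (Fin n)) ∈ layer X r a :=
  (h.cover x x.2).imp fun _ ha => mem_layer.2 ⟨x.2, ha⟩

theorem IsSupportedBy.isPartition_layerRelations (h : IsSupportedBy X r) :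
    Setoid.IsPartition (layerRelations X r) := by
  refine ⟨fun h0 => Set.not_nonempty_empty h0.1, ?_⟩
  rintro ⟨x, y⟩
  obtain ⟨a, ha⟩ := h.exists_mem_layer x
  obtain ⟨b, hb⟩ := h.exists_mem_layer y
  have hmem : (x, y) ∈ layerRelation X r a b
      (inner ℝ (x : EuclideanSpace ℝ (Fin n)) y / (r a * r b)) := ⟨ha, hb, rfl⟩
  refine ⟨_, ⟨⟨⟨_, hmem⟩, _, _, _, rfl⟩, hmem⟩, ?_⟩
  rintro R ⟨⟨-, a', b', α, rfl⟩, ha', hb', hα⟩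
  obtain rfl := eq_of_mem_layer h.radii_injective ha ha'
  obtain rfl := eq_of_mem_layer h.radii_injective hb hb'
  rw [← hα]

theorem IsSupportedBy.exists_sUnion_eq_diagonal (h : IsSupportedBy X r) :
    ∃ 𝓓 ⊆ layerRelations X r, ⋃₀ 𝓓 = Set.diagonal X := by
  refine ⟨{R ∈ layerRelations X r | R ⊆ Set.diagonal X}, fun R hR => hR.1,
    (Set.sUnion_subset fun R hR => hR.2).antisymm ?_⟩
  rintro ⟨x, y⟩ hxy
  obtain rfl : x = y := hxy
  obtain ⟨a, ha⟩ := h.exists_mem_layer x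
  have hmem : (x, x) ∈ layerRelation X r a a
      (inner ℝ (x : EuclideanSpace ℝ (Fin n)) x / (r a * r a)) := ⟨ha, ha, rfl⟩
  refine ⟨_, ⟨⟨⟨_, hmem⟩, _, _, _, rfl⟩, ?_⟩, hmem⟩
  rintro ⟨u, v⟩ ⟨hu, hv, huv⟩
  dsimp only at hu hv huv
  apply Subtype.ext
  by_cases h0 : r a = 0
  · exact (eq_zero_of_mem_layer h0 hu).trans (eq_zero_of_mem_layer h0 hv).symm
  · rw [(inner_div_eq_one_iff h0 ha ha).2 rfl, inner_div_eq_one_iff h0 hu hv] at huv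
    exact huv.symm

theorem ncard_setOf_mem_layerRelation {a b c : Fin p} {α β : ℝ} {x y : X}
    (hx : (x : EuclideanSpace ℝ (Fin n)) ∈ layer X r a)
    (hy : (y : EuclideanSpace ℝ (Fin n)) ∈ layer X r c) :
    {z : X | (x, z) ∈ layerRelation X r a b α ∧ (z, y) ∈ layerRelation X r b c β}.ncard =
      jointCount X r a b c α β x y := by
  rw [jointCount, ← Set.ncard_coe_finset, ← Set.ncard_image_of_injective _ Subtype.val_injective]
  congr 1
  ext z
  simp only [Set.mem_image, Set.mem_ofPred_eq, mem_layerRelation, Finset.coe_filter]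
  constructor
  · rintro ⟨z, ⟨h₁, h₂⟩, rfl⟩
    exact ⟨h₁.2.1, h₁.2.2, h₂.2.2⟩
  · rintro ⟨hz, h₁, h₂⟩
    exact ⟨⟨z, (mem_layer.1 hz).1⟩, ⟨⟨hx, hz, h₁⟩, hz, hy, h₂⟩, rfl⟩

/-- The number of spheres of nonzero radius is `p - ε_S`. -/
theorem IsSupportedBy.card_radii_ne_zero (h : IsSupportedBy X r) {b : Fin p} (hb : r b ≠ 0) :
    ((Finset.univ.filter fun i => i ≠ b ∧ r i ≠ 0).card : ℤ) + 1 = p - epsilonS X := by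
  classical
  have h₁ : (Finset.univ.filter fun i => i ≠ b ∧ r i ≠ 0).card + 1 =
      (Finset.univ.filter fun i => r i ≠ 0).card := by
    rw [← Finset.card_erase_add_one (a := b) (s := Finset.univ.filter fun i => r i ≠ 0)
      (by simpa using hb)]
    congr 2
    ext i
    simp
  have h₂ := Finset.card_filter_add_card_filter_not (s := (Finset.univ : Finset (Fin p)))
    (fun i => r i = 0)
  have h₃ : ((Finset.univ.filter fun i => r i = 0).card : ℤ) = epsilonS X := by
    unfold epsilonS
    split_ifs with h0
    · obtain ⟨i, hi⟩ := h.cover 0 h0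
      rw [norm_zero] at hi
      have : (Finset.univ.filter fun i => r i = 0) = {i} := by
        ext j
        simp only [Finset.mem_filter, Finset.mem_univ, true_and, Finset.mem_singleton]
        exact ⟨fun hj => h.radii_injective (hj.trans hi), fun hj => hj ▸ hi.symm⟩
      simp [this]
    · rw [Nat.cast_eq_zero, Finset.card_eq_zero, Finset.filter_eq_empty_iff]
      intro i _ hi
      obtain ⟨x, hx⟩ := h.layer_nonempty i
      exact h0 (eq_zero_of_mem_layer hi hx ▸ (mem_layer.1 hx).1)
  rw [Finset.card_univ, Fintype.card_fin] at h₂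
  simp only [ne_eq] at h₁ ⊢
  omega

end Angles

end EuclideanDesign

open EuclideanDesign in
theorem theorem1p2 (n : ℕ) (hn : 2 ≤ n) (t p : ℕ)
    (X : Finset (EuclideanSpace ℝ (Fin n))) (w : EuclideanSpace ℝ (Fin n) → ℝ) (r : Fin p → ℝ)
    (hX : EuclideanDesign.IsDesign t X w r)
    (hw : ∀ i : Fin p, ∃ c : ℝ, ∀ x ∈ EuclideanDesign.layer X r i, w x = c)
    (h : (∀ a b c : Fin p, r a ≠ 0 → r b ≠ 0 → r c ≠ 0 →
            (EuclideanDesign.angleCount X r a b : ℤ) + EuclideanDesign.angleCount X r b c ≤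
              t - 2 * (p - EuclideanDesign.epsilonS X - 2)) ∨
          (EuclideanDesign.IsAntipodal X ∧
            ∀ a b c : Fin p, r a ≠ 0 → r b ≠ 0 → r c ≠ 0 →
              (EuclideanDesign.angleCount X r a b : ℤ) + EuclideanDesign.angleCount X r b c
                  - (if a = b then 1 else 0) - (if b = c then 1 else 0) ≤
                t - 2 * (p - EuclideanDesign.epsilonS X - 2))) :
    IsCoherentConfiguration (EuclideanDesign.layerRelations X r) := by
  have hS := hX.supported
  have hr := hS.radii_injective
  have hcard : ∀ a b c, r a ≠ 0 → r b ≠ 0 → r c ≠ 0 →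
      (nontrivialAngles X r a b).card + (nontrivialAngles X r c b).card +
        2 * (Finset.univ.filter fun i => i ≠ b ∧ r i ≠ 0).card ≤ t + 2 := by
    intro a b c ha hb hc
    have hq := hS.card_radii_ne_zero hb
    rcases h with h | ⟨hanti, h⟩
    · have h := h a b c ha hb hc
      have h₁ := card_nontrivialAngles_le (X := X) hr ha b
      have h₂ := card_nontrivialAngles_le (X := X) hr hc b
      rw [angleCount_comm c b] at h₂
      omega
    · have h := h a b c ha hb hc
      have h₁ := card_nontrivialAngles_add_le hanti hS ha b
      have h₂ := card_nontrivialAngles_add_le hanti hS hc b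
      rw [angleCount_comm c b] at h₂
      simp only [eq_comm (a := c)] at h₂
      split_ifs at h h₁ h₂ <;> omega
  refine ⟨hS.isPartition_layerRelations, hS.exists_sUnion_eq_diagonal, ?_, ?_⟩
  · rintro R ⟨hne, a, b, α, rfl⟩
    exact ⟨hne.preimage Prod.swap_surjective, b, a, α, swap_preimage_layerRelation a b α⟩
  · rintro R₁ ⟨-, a, b, α, rfl⟩ R₂ ⟨-, b', c, β, rfl⟩ R₃ ⟨⟨⟨x₀, y₀⟩, h₀⟩, a', c', γ, rfl⟩
    rw [mem_layerRelation] at h₀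
    by_cases habc : a = a' ∧ b = b' ∧ c = c'
    · obtain ⟨rfl, rfl, rfl⟩ := habc
      refine ⟨jointCount X r a b c α β x₀ y₀, fun x y hxy => ?_⟩
      rw [mem_layerRelation] at hxy
      rw [ncard_setOf_mem_layerRelation hxy.1 hxy.2.1]
      exact hX.jointCount_congr (by omega) hw hcard α β hxy.1 h₀.1 hxy.2.1 h₀.2.1
        (hxy.2.2.trans h₀.2.2.symm)
    · refine ⟨0, fun x y hxy => ?_⟩
      rw [Set.ncard_eq_zero, Set.eq_empty_iff_forall_notMem]
      rintro z ⟨hxz, hzy⟩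
      exact habc ⟨eq_of_mem_layer hr hxz.1 hxy.1, eq_of_mem_layer hr hxz.2.1 hzy.1,
        eq_of_mem_layer hr hzy.2.1 hxy.2.1⟩
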